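/- Conventions. All groups are discrete and need be neither countable nor finitely generated. For a map $\phi\colon G\to H$ between groups, $\phi$ is a quasi-homomorphism if the set of defects $\{\phi(y)^{-1}\phi(x)^{-1}\phi(xy) : x,y\in G\}$ is finite, and $\phi$ is coarsely surjective if $H=\phi(G)A$ for some finite $A\subseteq H$. Groups $G$ and $G'$ are quasi-isomorphic if there are quasi-homomorphisms $\phi\colon G\to G'$ and $\phi'\colon G'\to G$ such that the sets $\{\phi'(\phi(g))^{-1}g : g\in G\}$ and $\{\phi(\phi'(g'))^{-1}g' : g'\in G'\}$ are finite. For a (possibly infinite) generating set $S$ of $G$ let $\mathcal G(G,S)$ be the Cayley graph and $d_S$ the word metric. For generating sets write $S\preceq T$ if the identity map $(G,d_T)\to(G,d_S)$ is Lipschitz; this is a preorder, which induces an equivalence relation ($S\sim T$ iff $S\preceq T$ and $T\preceq S$) and a partial order $\preccurlyeq$ on the equivalence classes $[S]$. Let $\mathcal H(G)$, the poset of hyperbolic structures on $G$, be the set of the classes $[S]$ such that $\mathcal G(G,S)$ is Gromov hyperbolic, with the induced order. Proposition. (1) Let $\phi\colon G\to H$ be a coarsely surjective quasi-homomorphism.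 Then $\phi$ induces an order-embedding $\chi\colon\mathcal H(H)\to\mathcal H(G)$: we have $a\preccurlyeq b$ if and only if $\chi(a)\preccurlyeq\chi(b)$ for all $a,b\in\mathcal H(H)$, and, for all $[T]\in\mathcal H(H)$ and all generating sets $S$ of $G$, we have $\chi([T])=[S]$ if and only if $\phi\colon(G,d_S)\to(H,d_T)$ is a quasi-isometry. (2) If $G$ and $G'$ are quasi-isomorphic, then the posets $\mathcal H(G)$ and $\mathcal H(G')$ are isomorphic. -/

import Mathlib

open scoped NNReal

namespace HypStruct

section Maps

/-- The set of defects `{φ(y)⁻¹ φ(x)⁻¹ φ(xy) : x, y ∈ G}` of a map between groups. -/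
def defectSet {G H : Type*} [Group G] [Group H] (φ : G → H) : Set H :=
  {d | ∃ x y : G, d = (φ y)⁻¹ * (φ x)⁻¹ * φ (x * y)}

/-- A quasi-homomorphism of discrete groups: the set of defects is finite. -/
def IsQuasiHom {G H : Type*} [Group G] [Group H] (φ : G → H) : Prop :=
  (defectSet φ).Finite

/-- `dist (φ, ψ) < ∞` for maps into a discrete group: the set `{φ(x)⁻¹ ψ(x) : x ∈ X}` is finite. -/
def FiniteDist {X H : Type*} [Group H] (φ ψ : X → H) : Prop :=
  (Set.range fun x => (φ x)⁻¹ * ψ x).Finite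

/-- Coarse surjectivity for maps into a discrete group: `H = φ(X) · A` for a finite set `A`. -/
def IsCoarselySurjective {X H : Type*} [Group H] (φ : X → H) : Prop :=
  ∃ A : Set H, A.Finite ∧ ∀ h : H, ∃ x : X, ∃ a ∈ A, h = φ x * a

/-- Two discrete groups are quasi-isomorphic: there are quasi-homomorphisms in both directions,
both of whose composites are at finite distance from the identity. -/
def QuasiIsomorphic (G H : Type*) [Group G] [Group H] : Prop :=
  ∃ (φ : G → H) (ψ : H → G), IsQuasiHom φ ∧ IsQuasiHom ψ ∧
    FiniteDist (ψ ∘ φ) id ∧ FiniteDist (φ ∘ ψ) id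

end Maps

section Graphs

/-- A walk in a graph is geodesic if its length is the graph distance of its endpoints. -/
def IsGeodesicWalk {V : Type*} {Γ : SimpleGraph V} {x y : V} (p : Γ.Walk x y) : Prop :=
  p.length = Γ.dist x y

/-- Gromov hyperbolicity of a (connected) graph: for some `δ`, all geodesic triangles are
`δ`-slim, i.e. each side is contained in the `δ`-neighbourhood of the union of the other two.
It is enough to require this of the side `p`, since the triangle is arbitrary. -/
def IsHyperbolicGraph {V : Type*} (Γ : SimpleGraph V) : Prop :=
  ∃ δ : ℕ, ∀ (x y z : V) (p : Γ.Walk x y) (q : Γ.Walk y z) (r : Γ.Walk z x),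
    IsGeodesicWalk p → IsGeodesicWalk q → IsGeodesicWalk r →
      ∀ v ∈ p.support, ∃ w, (w ∈ q.support ∨ w ∈ r.support) ∧ Γ.dist v w ≤ δ

/-- `f` is a quasi-isometry for the graph distances on the vertex sets of two (connected)
graphs. -/
def IsQuasiIsometry {V W : Type*} (Γ : SimpleGraph V) (Λ : SimpleGraph W) (f : V → W) : Prop :=
  ∃ L ε : ℝ, 1 ≤ L ∧ 0 ≤ ε ∧
    (∀ x y : V, (Γ.dist x y : ℝ) / L - ε ≤ (Λ.dist (f x) (f y) : ℝ) ∧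
      (Λ.dist (f x) (f y) : ℝ) ≤ L * (Γ.dist x y : ℝ) + ε) ∧
    ∀ w : W, ∃ x : V, (Λ.dist (f x) w : ℝ) ≤ ε

end Graphs

section Structures

/-- A (possibly infinite) generating set of a group. -/
structure GeneratingSet (G : Type*) [Group G] where
  carrier : Set G
  closure_eq_top : Subgroup.closure carrier = ⊤

/-- The Cayley graph of `G` with respect to a generating set. Its graph distance is the
(left-invariant) word metric. -/
def GeneratingSet.cayleyGraph {G : Type*} [Group G] (S : GeneratingSet G) : SimpleGraph G :=
  SimpleGraph.mulCayley S.carrier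

/-- The domination preorder: `S ≤ T` if the identity map of `G` is Lipschitz from the Cayley graph
of `T` to the Cayley graph of `S`. -/
instance {G : Type*} [Group G] : Preorder (GeneratingSet G) where
  le S T := ∃ K : ℝ≥0, ∀ x y : G,
    (S.cayleyGraph.dist x y : ℝ) ≤ K * (T.cayleyGraph.dist x y : ℝ)
  le_refl S := ⟨1, fun x y => by simp⟩
  le_trans S T U := by
    rintro ⟨K, hK⟩ ⟨K', hK'⟩
    refine ⟨K * K', fun x y => (hK x y).trans ?_⟩
    rw [NNReal.coe_mul, mul_assoc]
    exact mul_le_mul_of_nonneg_left (hK' x y) K.coe_nonneg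

/-- The poset of equivalence classes of generating sets of `G`, where `S` and `T` are equivalent
if `S ≤ T` and `T ≤ S`. -/
abbrev GeneratingClass (G : Type*) [Group G] : Type _ :=
  Antisymmetrization (GeneratingSet G) (· ≤ ·)

/-- The equivalence class `[S]` of a generating set `S`. -/
def GeneratingSet.cls {G : Type*} [Group G] (S : GeneratingSet G) : GeneratingClass G :=
  toAntisymmetrization (· ≤ ·) S

/-- The poset of hyperbolic structures on `G`: the classes `[S]` such that the Cayley graph of `S`
is hyperbolic, with the order induced from that of all classes of generating sets. -/
abbrev HyperbolicStructure (G : Type*) [Group G] : Type _ :=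
  {c : GeneratingClass G // ∃ S : GeneratingSet G, IsHyperbolicGraph S.cayleyGraph ∧ S.cls = c}

/-- The hyperbolic structure `[S]` of a generating set `S` with hyperbolic Cayley graph. -/
def GeneratingSet.structureOf {G : Type*} [Group G] (S : GeneratingSet G)
    (hS : IsHyperbolicGraph S.cayleyGraph) : HyperbolicStructure G :=
  ⟨S.cls, S, hS, rfl⟩

end Structures

end HypStruct

/-! A finite set is bounded in every word metric, so a quasi-homomorphism `φ` is a homomorphism up
to bounded error for any generating set `T` of `H`. Hence `T` can be pulled back: the elements `g`
for which `φ g` has bounded `T`-length generate `G`, and `φ` becomes a quasi-isometry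
(`exists_isQuasiIsometry`). Two pullbacks along the same `φ` compare exactly as the original metrics
do (`le_of_isQuasiIsometry`, `le_of_isCoarselySurjective`), so `[T] ↦ [S]` is an order-embedding.

The pullback is again hyperbolic because hyperbolicity passes along quasi-isometric embeddings
(`IsHyperbolicGraph.of_quasiIsometricEmbedding`). This rests on the Morse lemma: in a hyperbolic
graph, quasi-geodesics and geodesics with common endpoints are uniformly close.

For quasi-isomorphic groups with coarse inverses `φ` and `ψ`, pulling a structure on `G` back along
`ψ` gives a preimage under the embedding induced by `φ`, which is therefore onto. -/

namespace HypStruct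

open SimpleGraph

/-! ### Slim triangles in terms of metric intervals -/

section Intervals

variable {V : Type*} {Γ : SimpleGraph V}

/-- `v` lies on a geodesic from `x` to `y`. -/
def Between (Γ : SimpleGraph V) (x v y : V) : Prop :=
  Γ.dist x v + Γ.dist v y = Γ.dist x y

theorem Between.symm {x v y : V} (h : Between Γ x v y) : Between Γ y v x := by
  unfold Between at *
  have h1 := Γ.dist_comm (u := x) (v := v)
  have h2 := Γ.dist_comm (u := v) (v := y)
  have h3 := Γ.dist_comm (u := x) (v := y)
  omega

/-- Slimness of geodesic triangles, expressed through the points between two vertices. -/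
def IntervalSlim (Γ : SimpleGraph V) (δ : ℕ) : Prop :=
  ∀ x y z v, Between Γ x v y → ∃ w, (Between Γ y w z ∨ Between Γ z w x) ∧ Γ.dist v w ≤ δ

theorem dist_le_mul_of_dist_succ_le (hΓ : Γ.Connected) {c : ℕ → V} {K : ℕ}
    (hc : ∀ i, Γ.dist (c i) (c (i + 1)) ≤ K) (i n : ℕ) : Γ.dist (c i) (c (i + n)) ≤ K * n := by
  induction n with
  | zero => simp
  | succ n ih =>
    have := hΓ.dist_triangle (u := c i) (v := c (i + n)) (w := c (i + n + 1))
    have := hc (i + n)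
    rw [← Nat.add_assoc, Nat.mul_succ]
    omega

/-- Past its end `getVert` is constant, so the bound needs no restriction on `i` and walks give
sequences on all of `ℕ`. -/
theorem dist_getVert_succ_le {x y : V} (p : Γ.Walk x y) (i : ℕ) :
    Γ.dist (p.getVert i) (p.getVert (i + 1)) ≤ 1 := by
  rcases lt_or_ge i p.length with h | h
  · exact (SimpleGraph.dist_eq_one_iff_adj.2 (p.adj_getVert_succ h)).le
  · rw [p.getVert_of_length_le h, p.getVert_of_length_le (h.trans (Nat.le_succ i))]
    simp

theorem IsGeodesicWalk.dist_getVert (hΓ : Γ.Connected) {x y : V} {p : Γ.Walk x y}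
    (hp : IsGeodesicWalk p) {i j : ℕ} (hij : i ≤ j) (hj : j ≤ p.length) :
    Γ.dist (p.getVert i) (p.getVert j) = j - i := by
  have h1 := dist_le_mul_of_dist_succ_le hΓ (dist_getVert_succ_le p) 0 i
  have h2 := dist_le_mul_of_dist_succ_le hΓ (dist_getVert_succ_le p) i (j - i)
  have h3 := dist_le_mul_of_dist_succ_le hΓ (dist_getVert_succ_le p) j (p.length - j)
  rw [Nat.add_sub_cancel' hij] at h2
  rw [Nat.add_sub_cancel' hj, p.getVert_length] at h3
  rw [Nat.zero_add, p.getVert_zero] at h1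
  have h4 := hΓ.dist_triangle (u := x) (v := p.getVert i) (w := y)
  have h5 := hΓ.dist_triangle (u := p.getVert i) (v := p.getVert j) (w := y)
  have h6 : p.length = Γ.dist x y := hp
  omega

theorem IsGeodesicWalk.between_getVert (hΓ : Γ.Connected) {x y : V} {p : Γ.Walk x y}
    (hp : IsGeodesicWalk p) {i : ℕ} (hi : i ≤ p.length) : Between Γ x (p.getVert i) y := by
  have h1 := hp.dist_getVert hΓ (Nat.zero_le i) hi
  have h2 := hp.dist_getVert hΓ hi le_rfl
  have h6 : p.length = Γ.dist x y := hp
  rw [p.getVert_zero] at h1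
  rw [p.getVert_length] at h2
  unfold Between
  omega

theorem IsGeodesicWalk.between_of_mem_support (hΓ : Γ.Connected) {x y v : V} {p : Γ.Walk x y}
    (hp : IsGeodesicWalk p) (hv : v ∈ p.support) : Between Γ x v y := by
  obtain ⟨i, rfl, hi⟩ := Walk.mem_support_iff_exists_getVert.1 hv
  exact hp.between_getVert hΓ hi

theorem exists_isGeodesicWalk (hΓ : Γ.Connected) (x y : V) :
    ∃ p : Γ.Walk x y, IsGeodesicWalk p :=
  hΓ.exists_walk_length_eq_dist x y

theorem Between.exists_isGeodesicWalk (hΓ : Γ.Connected) {x v y : V} (h : Between Γ x v y) :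
    ∃ p : Γ.Walk x y, IsGeodesicWalk p ∧ v ∈ p.support := by
  obtain ⟨p, hp⟩ := HypStruct.exists_isGeodesicWalk hΓ x v
  obtain ⟨q, hq⟩ := HypStruct.exists_isGeodesicWalk hΓ v y
  refine ⟨p.append q, ?_, ?_⟩
  · unfold IsGeodesicWalk Between at *
    rw [Walk.length_append]
    omega
  · rw [Walk.mem_support_append_iff]
    exact Or.inl p.end_mem_support

theorem exists_between_dist_eq (hΓ : Γ.Connected) (x y : V) {k : ℕ} (hk : k ≤ Γ.dist x y) :
    ∃ v, Between Γ x v y ∧ Γ.dist x v = k := by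
  obtain ⟨p, hp⟩ := exists_isGeodesicWalk hΓ x y
  have hk' : k ≤ p.length := hk.trans_eq (Eq.symm hp)
  refine ⟨p.getVert k, hp.between_getVert hΓ hk', ?_⟩
  have := hp.dist_getVert hΓ (Nat.zero_le k) hk'
  rwa [p.getVert_zero, Nat.sub_zero] at this

theorem IsHyperbolicGraph.exists_intervalSlim (hΓ : Γ.Connected) (h : IsHyperbolicGraph Γ) :
    ∃ δ, IntervalSlim Γ δ := by
  obtain ⟨δ, h⟩ := h
  refine ⟨δ, fun x y z v hv => ?_⟩
  obtain ⟨p, hp, hvp⟩ := hv.exists_isGeodesicWalk hΓ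
  obtain ⟨q, hq⟩ := exists_isGeodesicWalk hΓ y z
  obtain ⟨r, hr⟩ := exists_isGeodesicWalk hΓ z x
  obtain ⟨w, hw, hd⟩ := h x y z p q r hp hq hr v hvp
  exact ⟨w, hw.imp (hq.between_of_mem_support hΓ) (hr.between_of_mem_support hΓ), hd⟩

/-- Two geodesics with the same endpoints are close to each other. -/
theorem IntervalSlim.exists_mem_support (hΓ : Γ.Connected) {δ : ℕ} (h : IntervalSlim Γ δ)
    {x y w : V} (hw : Between Γ x w y) {p : Γ.Walk x y} (hp : IsGeodesicWalk p) :
    ∃ u ∈ p.support, Γ.dist w u ≤ 2 * δ := by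
  have hlen : p.length = Γ.dist x y := hp
  have hk : Γ.dist x w ≤ p.length := by unfold Between at hw; omega
  refine ⟨p.getVert (Γ.dist x w), p.getVert_mem_support _, ?_⟩
  have hu := hp.between_getVert hΓ hk
  have hxu := hp.dist_getVert hΓ (Nat.zero_le _) hk
  rw [p.getVert_zero, Nat.sub_zero] at hxu
  generalize p.getVert (Γ.dist x w) = u at *
  -- Here `u` is the point of `p` at the same distance from `x` as `w`. In the degenerate triangle
  -- `x, y, u` the point `t` is `δ`-close to `w`, and comparing distances to `x` or to `y` puts it
  -- `δ`-close to `u`.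
  obtain ⟨t, ht, hd⟩ := h x y u w hw
  unfold Between at *
  have h1 := hΓ.dist_triangle (u := w) (v := t) (w := u)
  have h2 := hΓ.dist_triangle (u := x) (v := w) (w := t)
  have h3 := hΓ.dist_triangle (u := x) (v := t) (w := w)
  have h4 := hΓ.dist_triangle (u := y) (v := t) (w := w)
  have h5 := hΓ.dist_triangle (u := y) (v := w) (w := t)
  have c1 := Γ.dist_comm (u := w) (v := t)
  have c2 := Γ.dist_comm (u := u) (v := t)
  have c3 := Γ.dist_comm (u := y) (v := w)
  have c4 := Γ.dist_comm (u := y) (v := u)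
  have c5 := Γ.dist_comm (u := x) (v := u)
  have c6 := Γ.dist_comm (u := x) (v := t)
  omega

/-- Slimness of intervals gives a point on some geodesic side at cost `δ`; moving it to the
prescribed side costs `2 * δ` more. -/
theorem IntervalSlim.isHyperbolicGraph (hΓ : Γ.Connected) {δ : ℕ} (h : IntervalSlim Γ δ) :
    IsHyperbolicGraph Γ := by
  refine ⟨3 * δ, fun x y z p q r hp hq hr v hv => ?_⟩
  obtain ⟨w, hw, hd⟩ := h x y z v (hp.between_of_mem_support hΓ hv)
  rcases hw with hw | hw
  · obtain ⟨u, hu, hwu⟩ := h.exists_mem_support hΓ hw hq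
    exact ⟨u, Or.inl hu, (hΓ.dist_triangle (v := w)).trans (by omega)⟩
  · obtain ⟨u, hu, hwu⟩ := h.exists_mem_support hΓ hw hr
    exact ⟨u, Or.inr hu, (hΓ.dist_triangle (v := w)).trans (by omega)⟩

end Intervals

/-! ### The Morse lemma and inheritance of hyperbolicity -/

section Morse

variable {V : Type*} {Γ : SimpleGraph V}

theorem mul_succ_le_two_pow {c k : ℕ} (hk : 2 * c + 1 ≤ k) : c * (k + 1) ≤ 2 ^ k := by
  obtain ⟨m, rfl⟩ : ∃ m, k = c + (m + 1) := ⟨k - c - 1, by omega⟩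
  have h1 : c < 2 ^ c := Nat.lt_two_pow_self
  have h2 : m < 2 ^ m := Nat.lt_two_pow_self
  rw [pow_add, pow_succ]
  exact Nat.mul_le_mul h1.le (by omega)

/-- A number bounded by a multiple of its own logarithm is bounded; this ends the Morse argument. -/
theorem exists_bound_of_le_clog (A δ B C : ℕ) :
    ∃ M, ∀ D, D ≤ A + δ * Nat.clog 2 (B * D + C) → D ≤ M := by
  set a := B * A + B * δ + C with ha
  refine ⟨A + δ * (2 * a + 1), fun D hD => hD.trans ?_⟩
  gcongr
  -- If `k` is the logarithm and `k > 2 * a + 1`, then `2 ^ (k - 1) < B * D + C ≤ a * k ≤ 2 ^ (k -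
  -- 1)`.
  by_contra! hk
  set k := Nat.clog 2 (B * D + C) with hkdef
  have h1 : 2 ^ k.pred < B * D + C := by
    refine Nat.pow_pred_clog_lt_self one_lt_two ?_
    by_contra! hle
    have : k = 0 := Nat.clog_of_right_le_one hle 2
    omega
  obtain ⟨j, hj⟩ : ∃ j, k = j + 1 := ⟨k - 1, by omega⟩
  rw [hj, Nat.pred_succ] at h1
  rw [hj] at hD hk
  have h2 := mul_succ_le_two_pow (c := a) (k := j) (by omega)
  have h3 : B * D ≤ B * (A + δ * (j + 1)) := Nat.mul_le_mul_left _ hD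
  have h4 : B * (A + δ * (j + 1)) + C ≤ a * (j + 1) := by
    rw [ha]
    nlinarith [Nat.zero_le (B * A * j), Nat.zero_le (C * j)]
  omega

/-- A path of length at most `2 ^ k` stays close to every geodesic joining its endpoints, up to an
error which is linear in `k`. -/
theorem IntervalSlim.exists_dist_le_of_le_two_pow (hΓ : Γ.Connected) {δ : ℕ}
    (h : IntervalSlim Γ δ) {c : ℕ → V} {K : ℕ} (hc : ∀ i, Γ.dist (c i) (c (i + 1)) ≤ K) (k : ℕ) :
    ∀ a n : ℕ, n ≤ 2 ^ k → ∀ v, Between Γ (c a) v (c (a + n)) →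
      ∃ i, i ≤ a + n ∧ Γ.dist v (c i) ≤ δ * k + K := by
  induction k with
  | zero =>
    intro a n hn v hv
    refine ⟨a, by omega, ?_⟩
    have h1 := dist_le_mul_of_dist_succ_le hΓ hc a n
    have h2 : K * n ≤ K * 1 := Nat.mul_le_mul_left _ (by simpa using hn)
    have h3 := Γ.dist_comm (u := v) (v := c a)
    unfold Between at hv
    omega
  | succ k ih =>
    intro a n hn v hv
    rw [pow_succ] at hn
    rcases le_or_gt n (2 ^ k) with hle | hlt
    · obtain ⟨i, hi, hd⟩ := ih a n hle v hv
      exact ⟨i, hi, hd.trans (by gcongr; omega)⟩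
    -- Cut the path at `c (a + 2 ^ k)`: slimness moves `v`, at cost `δ`, to a geodesic spanning one
    -- of the two pieces.
    · obtain ⟨m, rfl⟩ : ∃ m, n = 2 ^ k + m := ⟨n - 2 ^ k, by omega⟩
      obtain ⟨w, hw, hd⟩ := h _ _ (c (a + 2 ^ k)) v hv
      rw [← Nat.add_assoc] at hw
      rcases hw with hw | hw
      · obtain ⟨i, hi, hd'⟩ := ih _ m (by omega) w hw.symm
        refine ⟨i, by omega, (hΓ.dist_triangle (v := w)).trans ?_⟩
        rw [Nat.mul_succ]; omega
      · obtain ⟨i, hi, hd'⟩ := ih a _ le_rfl w hw.symm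
        refine ⟨i, by omega, (hΓ.dist_triangle (v := w)).trans ?_⟩
        rw [Nat.mul_succ]; omega

/-- A discrete quasi-geodesic `c 0, …, c N`. -/
structure IsQuasiGeodesic (Γ : SimpleGraph V) (K L E N : ℕ) (c : ℕ → V) : Prop where
  dist_succ_le : ∀ i, Γ.dist (c i) (c (i + 1)) ≤ K
  sub_le : ∀ i j, i ≤ N → j ≤ N → j - i ≤ L * Γ.dist (c i) (c j) + E

/-- Going back `2 * D` from `v` towards `x` gives `u`, and a geodesic of length at most `D` from `u`
to `C` cannot come closer than `D` to `v`. If `x` is already within `2 * D`, take `u = s = x`. -/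
theorem exists_avoiding_geodesic (hΓ : Γ.Connected) {x v : V} {D : ℕ} {C : Set V} (hx : x ∈ C)
    (hC : ∀ u, Between Γ x u v → ∃ s ∈ C, Γ.dist u s ≤ D) (hv : ∀ s ∈ C, D ≤ Γ.dist v s) :
    ∃ u, ∃ s ∈ C, Between Γ x u v ∧ Γ.dist u s ≤ D ∧ Γ.dist v u ≤ 2 * D ∧
      ∀ w, Between Γ u w s → D ≤ Γ.dist v w := by
  rcases le_or_gt (Γ.dist v x) (2 * D) with hle | hlt
  · refine ⟨x, x, hx, by simp [Between], by simp, hle, fun w hw => ?_⟩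
    simp only [Between, dist_self, Nat.add_eq_zero_iff] at hw
    rw [← hΓ.dist_eq_zero_iff.1 hw.1]
    exact hv x hx
  · obtain ⟨u, hu, hd⟩ := exists_between_dist_eq hΓ v x hlt.le
    obtain ⟨s, hs, hus⟩ := hC u hu.symm
    refine ⟨u, s, hs, hu.symm, hus, hd.le, fun w hw => ?_⟩
    have h1 := hΓ.dist_triangle (u := v) (v := w) (w := u)
    have h2 := Γ.dist_comm (u := u) (v := w)
    unfold Between at hw
    omega

/-- Geodesics are close to quasi-geodesics with the same endpoints. -/
theorem IntervalSlim.exists_dist_le_of_between (hΓ : Γ.Connected) {δ : ℕ}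
    (h : IntervalSlim Γ δ) (K L E : ℕ) :
    ∃ D, ∀ N c, IsQuasiGeodesic Γ K L E N c → ∀ v, Between Γ (c 0) v (c N) →
      ∃ i ≤ N, Γ.dist v (c i) ≤ D := by
  obtain ⟨M, hM⟩ := exists_bound_of_le_clog (2 * δ + K) δ (L * 6) E
  refine ⟨M, fun N c hc => ?_⟩
  classical
  have hex : ∃ D, ∀ v, Between Γ (c 0) v (c N) → ∃ i ≤ N, Γ.dist v (c i) ≤ D := by
    refine ⟨Γ.dist (c 0) (c N), fun v hv => ⟨N, le_rfl, ?_⟩⟩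
    unfold Between at hv
    omega
  -- With `D` least, some `v` on the interval has distance at least `D` from the whole path. The aim
  -- is to bound `D` by its own logarithm.
  obtain ⟨D, hD, hmin⟩ : ∃ D, (∀ v, Between Γ (c 0) v (c N) → ∃ i ≤ N, Γ.dist v (c i) ≤ D) ∧
      ∀ D' < D, ¬ ∀ v, Between Γ (c 0) v (c N) → ∃ i ≤ N, Γ.dist v (c i) ≤ D' :=
    ⟨Nat.find hex, Nat.find_spec hex, fun D' => Nat.find_min hex⟩
  suffices hDM : D ≤ M by
    intro v hv
    obtain ⟨i, hi, hd⟩ := hD v hv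
    exact ⟨i, hi, hd.trans hDM⟩
  rcases Nat.eq_zero_or_pos D with rfl | hpos
  · exact Nat.zero_le _
  apply hM
  have hnot := hmin (D - 1) (by omega)
  push Not at hnot
  obtain ⟨v, hv, hfar⟩ := hnot
  have hlog : ∀ i j w, i ≤ N → j ≤ N → i ≤ j → Γ.dist (c i) (c j) ≤ 6 * D →
      Between Γ (c i) w (c j) →
      ∃ m ≤ N, Γ.dist w (c m) ≤ δ * Nat.clog 2 (L * 6 * D + E) + K := by
    intro i j w hi hj hij hd hw
    have h1 := hc.sub_le i j hi hj
    have h2 : L * Γ.dist (c i) (c j) ≤ L * 6 * D := by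
      rw [Nat.mul_assoc]; exact Nat.mul_le_mul_left _ hd
    obtain ⟨m, hm, hd⟩ := h.exists_dist_le_of_le_two_pow hΓ hc.dist_succ_le
      (Nat.clog 2 (L * 6 * D + E)) i (j - i)
      (le_trans (by omega) (Nat.le_pow_clog one_lt_two _)) w
      (by rwa [Nat.add_sub_cancel' hij])
    exact ⟨m, by omega, hd⟩
  have hfar' : ∀ s ∈ c '' {i | i ≤ N}, D ≤ Γ.dist v s := by
    rintro _ ⟨i, hi, rfl⟩
    have := hfar i hi
    omega
  obtain ⟨u, _, ⟨i, hi, rfl⟩, hu, hus, hvu, hav⟩ :=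
    exists_avoiding_geodesic hΓ (x := c 0) (v := v) (D := D) (C := c '' {i | i ≤ N})
      ⟨0, Nat.zero_le _, rfl⟩ (fun u hu => by
        obtain ⟨i, hi, hd⟩ := hD u (by
          have h1 := hΓ.dist_triangle (u := u) (v := v) (w := c N)
          have h2 := hΓ.dist_triangle (u := c 0) (v := u) (w := c N)
          unfold Between at *
          omega)
        exact ⟨_, ⟨i, hi, rfl⟩, hd⟩) hfar'
  obtain ⟨u', _, ⟨j, hj, rfl⟩, hu', hus', hvu', hav'⟩ :=
    exists_avoiding_geodesic hΓ (x := c N) (v := v) (D := D) (C := c '' {i | i ≤ N})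
      ⟨N, le_refl N, rfl⟩ (fun u hu => by
        obtain ⟨i, hi, hd⟩ := hD u (by
          have h1 := hΓ.dist_triangle (u := u) (v := v) (w := c 0)
          have h2 := hΓ.dist_triangle (u := c N) (v := u) (w := c 0)
          have hu' := hu
          have hv' := hv.symm
          refine Between.symm ?_
          unfold Between at *
          omega)
        exact ⟨_, ⟨i, hi, rfl⟩, hd⟩) hfar'
  have huu' : Between Γ u v u' := by
    have h1 := hΓ.dist_triangle (u := u) (v := v) (w := u')
    have h2 := hΓ.dist_triangle (u := u) (v := u') (w := c N)
    have h3 := hΓ.dist_triangle (u := c 0) (v := u) (w := c N)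
    have h4 := hu'.symm
    unfold Between at *
    omega
  -- The route through `u`, `v`, `u'` has length at most `D + 2 * D + 2 * D + D`.
  have hij : Γ.dist (c i) (c j) ≤ 6 * D := by
    have h1 := hΓ.dist_triangle (u := c i) (v := u) (w := c j)
    have h2 := hΓ.dist_triangle (u := u) (v := v) (w := c j)
    have h3 := hΓ.dist_triangle (u := v) (v := u') (w := c j)
    have c1 := Γ.dist_comm (u := c i) (v := u)
    have c2 := Γ.dist_comm (u := u) (v := v)
    omega
  -- Two slim triangles fill the quadrilateral `u, u', c j, c i`. If `v` is near a lateral side,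
  -- which avoids it, then `D ≤ 2 * δ`; otherwise it is near an interval from `c i` to `c j`, and
  -- `hlog` applies.
  obtain ⟨w, hw, hvw⟩ := h u u' (c j) v huu'
  rcases hw with hw | hw
  · have := hav' w hw
    omega
  obtain ⟨w', hw', hww'⟩ := h (c j) u (c i) w hw
  have hvw' := hΓ.dist_triangle (u := v) (v := w) (w := w')
  rcases hw' with hw' | hw'
  · have := hav w' hw'
    omega
  obtain ⟨m, hm, hd⟩ : ∃ m ≤ N, Γ.dist w' (c m) ≤ δ * Nat.clog 2 (L * 6 * D + E) + K := by
    rcases le_total i j with hle | hle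
    · exact hlog i j w' hi hj hle hij hw'
    · exact hlog j i w' hj hi hle (by rwa [Γ.dist_comm]) hw'.symm
  have h1 := hfar m hm
  have h2 := hΓ.dist_triangle (u := v) (v := w') (w := c m)
  omega

/-- Quasi-geodesics are close to geodesics with the same endpoints. -/
theorem IntervalSlim.exists_between_dist_le (hΓ : Γ.Connected) {δ : ℕ}
    (h : IntervalSlim Γ δ) (K L E : ℕ) :
    ∃ R, ∀ N c, IsQuasiGeodesic Γ K L E N c → ∀ m ≤ N,
      ∃ v, Between Γ (c 0) v (c N) ∧ Γ.dist (c m) v ≤ R := by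
  obtain ⟨D, hD⟩ := h.exists_dist_le_of_between hΓ K L E
  refine ⟨K * (L * (2 * D + 1) + E) + D, fun N c hc m hm => ?_⟩
  rcases hm.eq_or_lt with rfl | hlt
  · exact ⟨c m, by simp [Between], by simp⟩
  obtain ⟨p, hp⟩ := exists_isGeodesicWalk hΓ (c 0) (c N)
  classical
  -- Take the first vertex of `p` close to some `c j` with `j > m`. Its predecessor is close only to
  -- earlier indices, so the vertex is close to both `c i` and `c j` with `i ≤ m < j`; then `j - i`,
  -- hence `j - m`, is bounded.
  have hex : ∃ t, t ≤ p.length ∧ ∃ j ≤ N, m < j ∧ Γ.dist (p.getVert t) (c j) ≤ D :=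
    ⟨p.length, le_rfl, N, le_rfl, hlt, by rw [p.getVert_length]; simp⟩
  obtain ⟨t, ⟨ht, j, hj, hmj, hd⟩, hmin⟩ : ∃ t,
      (t ≤ p.length ∧ ∃ j ≤ N, m < j ∧ Γ.dist (p.getVert t) (c j) ≤ D) ∧
      ∀ t' < t, ¬ (t' ≤ p.length ∧ ∃ j ≤ N, m < j ∧ Γ.dist (p.getVert t') (c j) ≤ D) :=
    ⟨Nat.find hex, Nat.find_spec hex, fun t' => Nat.find_min hex⟩
  obtain ⟨i, hi, hdi⟩ : ∃ i ≤ m, Γ.dist (c i) (p.getVert t) ≤ D + 1 := by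
    rcases t with _ | t
    · exact ⟨0, Nat.zero_le _, by rw [p.getVert_zero]; simp⟩
    · obtain ⟨i, hi, hdi⟩ := hD N c hc (p.getVert t) (hp.between_getVert hΓ (by omega))
      refine ⟨i, ?_, ?_⟩
      · by_contra! hlt'
        exact hmin t (by omega) ⟨by omega, i, hi, hlt', hdi⟩
      · have h1 := hΓ.dist_triangle (u := c i) (v := p.getVert t) (w := p.getVert (t + 1))
        have h2 := dist_getVert_succ_le p t
        have h3 := Γ.dist_comm (u := c i) (v := p.getVert t)
        omega
  refine ⟨p.getVert t, hp.between_getVert hΓ ht, ?_⟩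
  have h1 := hΓ.dist_triangle (u := c i) (v := p.getVert t) (w := c j)
  have h2 := hc.sub_le i j (by omega) hj
  have h3 : L * Γ.dist (c i) (c j) ≤ L * (2 * D + 1) := Nat.mul_le_mul_left _ (by omega)
  have h4 := dist_le_mul_of_dist_succ_le hΓ hc.dist_succ_le m (j - m)
  rw [Nat.add_sub_cancel' hmj.le] at h4
  have h5 : K * (j - m) ≤ K * (L * (2 * D + 1) + E) := Nat.mul_le_mul_left _ (by omega)
  have h6 := hΓ.dist_triangle (u := c m) (v := c j) (w := p.getVert t)
  have h7 := Γ.dist_comm (u := c j) (v := p.getVert t)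
  omega

theorem IsGeodesicWalk.isQuasiGeodesic {W : Type*} {Λ : SimpleGraph W} (hΛ : Λ.Connected)
    {f : W → V} {K L E : ℕ} (hK : ∀ x y, Γ.dist (f x) (f y) ≤ K * Λ.dist x y)
    (hL : ∀ x y, Λ.dist x y ≤ L * Γ.dist (f x) (f y) + E) {x y : W} {p : Λ.Walk x y}
    (hp : IsGeodesicWalk p) : IsQuasiGeodesic Γ K L E p.length (f ∘ p.getVert) where
  dist_succ_le i := (hK _ _).trans (by
    simpa using Nat.mul_le_mul_left K (dist_getVert_succ_le p i))
  sub_le i j hi hj := by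
    rcases le_total i j with hij | hij
    · rw [← hp.dist_getVert hΛ hij hj]
      exact hL _ _
    · omega

/-- Hyperbolicity is inherited along quasi-isometric embeddings of connected graphs. -/
theorem IsHyperbolicGraph.of_quasiIsometricEmbedding {W : Type*} {Λ : SimpleGraph W}
    (hΓ : Γ.Connected) (hΛ : Λ.Connected) (hyp : IsHyperbolicGraph Γ)
    {f : W → V} {K L E : ℕ} (hK : ∀ x y, Γ.dist (f x) (f y) ≤ K * Λ.dist x y)
    (hL : ∀ x y, Λ.dist x y ≤ L * Γ.dist (f x) (f y) + E) : IsHyperbolicGraph Λ := by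
  obtain ⟨δ, h⟩ := hyp.exists_intervalSlim hΓ
  obtain ⟨D, hD⟩ := h.exists_dist_le_of_between hΓ K L E
  obtain ⟨R, hR⟩ := h.exists_between_dist_le hΓ K L E
  have hnear : ∀ y z w, Between Γ (f y) w (f z) → ∃ u, Between Λ y u z ∧ Γ.dist w (f u) ≤ D := by
    intro y z w hw
    obtain ⟨q, hq⟩ := exists_isGeodesicWalk hΛ y z
    obtain ⟨i, hi, hd⟩ := hD _ _ (hq.isQuasiGeodesic hΛ hK hL) w (by simpa using hw)
    exact ⟨q.getVert i, hq.between_getVert hΛ hi, hd⟩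
  -- Cross to the interval in `Γ` (`R`), to another side (`δ`), back to the image of a geodesic
  -- (`D`), then pull back by `hL`.
  suffices IntervalSlim Λ (L * (R + δ + D) + E) from this.isHyperbolicGraph hΛ
  intro x y z v hv
  obtain ⟨p, hp, hvp⟩ := hv.exists_isGeodesicWalk hΛ
  obtain ⟨m, rfl, hm⟩ := Walk.mem_support_iff_exists_getVert.1 hvp
  obtain ⟨w, hw, hd⟩ := hR _ _ (hp.isQuasiGeodesic hΛ hK hL) m hm
  obtain ⟨w', hw', hd'⟩ := h (f x) (f y) (f z) w (by simpa using hw)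
  obtain ⟨u, hu, hd''⟩ : ∃ u, (Between Λ y u z ∨ Between Λ z u x) ∧ Γ.dist w' (f u) ≤ D := by
    rcases hw' with hw' | hw'
    · obtain ⟨u, hu, hdu⟩ := hnear _ _ _ hw'
      exact ⟨u, Or.inl hu, hdu⟩
    · obtain ⟨u, hu, hdu⟩ := hnear _ _ _ hw'
      exact ⟨u, Or.inr hu, hdu⟩
  refine ⟨u, hu, (hL _ _).trans ?_⟩
  gcongr
  have h1 := hΓ.dist_triangle (u := f (p.getVert m)) (v := w) (w := f u)
  have h2 := hΓ.dist_triangle (u := w) (v := w') (w := f u)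
  simp only [Function.comp_apply] at hd
  omega

end Morse

end HypStruct

namespace HypStruct

open SimpleGraph

/-! ### Word metrics and domination -/

section WordMetric

theorem dist_le_mul_of_adj {V W : Type*} {Γ : SimpleGraph V} {Λ : SimpleGraph W}
    (hΓ : Γ.Connected) (hΛ : Λ.Connected) {f : W → V} {K : ℕ}
    (hK : ∀ x y, Λ.Adj x y → Γ.dist (f x) (f y) ≤ K) (x y : W) :
    Γ.dist (f x) (f y) ≤ K * Λ.dist x y := by
  obtain ⟨p, hp⟩ := hΛ.exists_walk_length_eq_dist x y
  rw [← hp]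
  clear hp
  induction p with
  | nil => simp
  | cons h p ih =>
    refine (hΓ.dist_triangle (v := f _)).trans ((Nat.add_le_add (hK _ _ h) ih).trans ?_)
    rw [Walk.length_cons, Nat.mul_succ, Nat.add_comm]

variable {G H : Type*} [Group G] [Group H]

theorem inv_mul_mem_closure_of_walk {s : Set G} {x y : G} (p : (mulCayley s).Walk x y) :
    x⁻¹ * y ∈ Subgroup.closure s := by
  induction p with
  | nil => simp [one_mem]
  | @cons u v w h p ih =>
    have huv : u⁻¹ * v ∈ Subgroup.closure s := by
      rcases ((mulCayley_adj s u v).1 h).2 with h | h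
      · exact Subgroup.subset_closure h
      · simpa using inv_mem (Subgroup.subset_closure h)
    simpa [mul_assoc] using mul_mem huv ih

namespace GeneratingSet

theorem cayleyGraph_connected (S : GeneratingSet G) : S.cayleyGraph.Connected := by
  have key : ∀ g ∈ Subgroup.closure S.carrier, ∀ x, S.cayleyGraph.Reachable x (x * g) := by
    intro g hg
    induction hg using Subgroup.closure_induction with
    | mem g hg =>
      intro x
      by_cases h : x = x * g
      · rw [← h]
      · exact ((mulCayley_adj _ _ _).2 ⟨h, Or.inl (by simpa using hg)⟩ :
          S.cayleyGraph.Adj _ _).reachable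
    | one => intro x; rw [mul_one]
    | mul a b _ _ ha hb => intro x; rw [← mul_assoc]; exact (ha x).trans (hb _)
    | inv a _ ha => intro x; simpa using (ha (x * a⁻¹)).symm
  rw [connected_iff]
  refine ⟨fun x y => ?_, ⟨1⟩⟩
  simpa using key (x⁻¹ * y) (by rw [S.closure_eq_top]; trivial) x

theorem dist_mul_left (S : GeneratingSet G) (g x y : G) :
    S.cayleyGraph.dist (g * x) (g * y) = S.cayleyGraph.dist x y := by
  have key : ∀ g x y, S.cayleyGraph.dist (g * x) (g * y) ≤ S.cayleyGraph.dist x y := by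
    intro g x y
    have := dist_le_mul_of_adj S.cayleyGraph_connected S.cayleyGraph_connected
      (f := fun x => g * x) (K := 1)
      (fun x y h => (dist_eq_one_iff_adj.2 (mulCayley_adj_mul_iff_right.2 h)).le) x y
    simpa using this
  refine le_antisymm (key g x y) ?_
  simpa using key g⁻¹ (g * x) (g * y)

theorem exists_dist_le_of_finite (S : GeneratingSet G) {A : Set G} (hA : A.Finite) :
    ∃ C, ∀ x y, x⁻¹ * y ∈ A → S.cayleyGraph.dist x y ≤ C := by
  obtain ⟨C, hC⟩ := (hA.image (S.cayleyGraph.dist 1)).bddAbove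
  refine ⟨C, fun x y h => ?_⟩
  have := hC ⟨_, h, rfl⟩
  rw [← S.dist_mul_left x] at this
  simpa using this

/-- Distinct vertices have distance at least `1`, so an additive constant can be absorbed into the
Lipschitz factor. -/
theorem le_iff {S T : GeneratingSet G} :
    S ≤ T ↔ ∃ C : ℕ, ∀ x y, S.cayleyGraph.dist x y ≤ C * T.cayleyGraph.dist x y + C := by
  constructor
  · rintro ⟨K, hK⟩
    obtain ⟨n, hn⟩ := exists_nat_ge K
    refine ⟨n, fun x y => ?_⟩
    have hn' : (K : ℝ) ≤ n := by exact_mod_cast hn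
    have h : (S.cayleyGraph.dist x y : ℝ) ≤ n * T.cayleyGraph.dist x y :=
      (hK x y).trans (by gcongr)
    have h' : S.cayleyGraph.dist x y ≤ n * T.cayleyGraph.dist x y := by exact_mod_cast h
    omega
  · rintro ⟨C, hC⟩
    refine ⟨2 * C, fun x y => ?_⟩
    have h : S.cayleyGraph.dist x y ≤ 2 * C * T.cayleyGraph.dist x y := by
      rcases eq_or_ne x y with rfl | hne
      · simp
      · have h1 := hC x y
        have h2 := Nat.mul_le_mul_left C (T.cayleyGraph_connected.pos_dist_of_ne hne)
        rw [Nat.mul_assoc]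
        omega
    exact_mod_cast h

theorem cls_le_cls {S T : GeneratingSet G} : S.cls ≤ T.cls ↔ S ≤ T :=
  toAntisymmetrization_le_toAntisymmetrization_iff

end GeneratingSet

end WordMetric

/-! ### Quasi-isometries of Cayley graphs and transport of structures -/

section QuasiIsometry

theorem isQuasiIsometry_iff {V W : Type*} {Γ : SimpleGraph V} {Λ : SimpleGraph W} {f : V → W} :
    IsQuasiIsometry Γ Λ f ↔ ∃ C : ℕ,
      (∀ x y, Γ.dist x y ≤ C * Λ.dist (f x) (f y) + C) ∧
      (∀ x y, Λ.dist (f x) (f y) ≤ C * Γ.dist x y + C) ∧ ∀ w, ∃ x, Λ.dist (f x) w ≤ C := by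
  constructor
  · rintro ⟨L, ε, hL, hε, h, hs⟩
    obtain ⟨C, hC⟩ := exists_nat_ge (L * (ε + 1) + ε)
    have hLε : 0 ≤ L * ε := by positivity
    refine ⟨C, fun x y => ?_, fun x y => ?_, fun w => ?_⟩
    · have h1 := (h x y).1
      rw [tsub_le_iff_right, div_le_iff₀ (by linarith)] at h1
      have h2 : L * (Λ.dist (f x) (f y) : ℝ) ≤ C * Λ.dist (f x) (f y) := by
        gcongr; linarith
      have h3 : (Γ.dist x y : ℝ) ≤ C * Λ.dist (f x) (f y) + C := by linarith
      exact_mod_cast h3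
    · have h2 : L * (Γ.dist x y : ℝ) ≤ C * Γ.dist x y := by
        gcongr; linarith
      have h3 : (Λ.dist (f x) (f y) : ℝ) ≤ C * Γ.dist x y + C := by linarith [(h x y).2]
      exact_mod_cast h3
    · obtain ⟨x, hx⟩ := hs w
      have h3 : (Λ.dist (f x) w : ℝ) ≤ C := by linarith
      exact ⟨x, by exact_mod_cast h3⟩
  · rintro ⟨C, h1, h2, h3⟩
    refine ⟨C + 1, C, by simp, by simp, fun x y => ⟨?_, ?_⟩, fun w => ?_⟩
    · have h : (Γ.dist x y : ℝ) ≤ C * Λ.dist (f x) (f y) + C := by exact_mod_cast h1 x y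
      rw [tsub_le_iff_right, div_le_iff₀ (by positivity)]
      have h4 : (0 : ℝ) ≤ Λ.dist (f x) (f y) := by positivity
      nlinarith [sq_nonneg (C : ℝ)]
    · have h : (Λ.dist (f x) (f y) : ℝ) ≤ C * Γ.dist x y + C := by exact_mod_cast h2 x y
      have h4 : (0 : ℝ) ≤ Γ.dist x y := by positivity
      linarith
    · obtain ⟨x, hx⟩ := h3 w
      exact ⟨x, by exact_mod_cast hx⟩

variable {G H : Type*} [Group G] [Group H]

theorem le_of_isQuasiIsometry {φ : G → H} {S S' : GeneratingSet G} {T T' : GeneratingSet H}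
    (h : IsQuasiIsometry S.cayleyGraph T.cayleyGraph φ)
    (h' : IsQuasiIsometry S'.cayleyGraph T'.cayleyGraph φ) (hT : T ≤ T') : S ≤ S' := by
  obtain ⟨C, h1, -, -⟩ := isQuasiIsometry_iff.1 h
  obtain ⟨C', -, h2, -⟩ := isQuasiIsometry_iff.1 h'
  obtain ⟨K, hK⟩ := GeneratingSet.le_iff.1 hT
  refine GeneratingSet.le_iff.2 ⟨C * (K * C' + K) + C, fun x y => ?_⟩
  calc S.cayleyGraph.dist x y
      ≤ C * (K * (C' * S'.cayleyGraph.dist x y + C') + K) + C := by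
        refine (h1 x y).trans ?_
        gcongr
        refine (hK _ _).trans ?_
        gcongr
        exact h2 x y
    _ ≤ (C * (K * C' + K) + C) * S'.cayleyGraph.dist x y + (C * (K * C' + K) + C) := by
        have : 0 ≤ (C * K + C) * S'.cayleyGraph.dist x y := Nat.zero_le _
        nlinarith

/-- The two quasi-isometries compare distances only on `φ(G)`. The finite set `A` is bounded in both
word metrics, so the same moves to `φ(G)` work for `T` and `T'` at once. -/
theorem le_of_isCoarselySurjective {φ : G → H} (hφ : IsCoarselySurjective φ)
    {S S' : GeneratingSet G} {T T' : GeneratingSet H}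
    (h : IsQuasiIsometry S.cayleyGraph T.cayleyGraph φ)
    (h' : IsQuasiIsometry S'.cayleyGraph T'.cayleyGraph φ) (hS : S ≤ S') : T ≤ T' := by
  obtain ⟨C, -, h1, -⟩ := isQuasiIsometry_iff.1 h
  obtain ⟨C', h2, -, -⟩ := isQuasiIsometry_iff.1 h'
  obtain ⟨K, hK⟩ := GeneratingSet.le_iff.1 hS
  obtain ⟨A, hA, hsurj⟩ := hφ
  obtain ⟨a, ha⟩ := T.exists_dist_le_of_finite hA
  obtain ⟨a', ha'⟩ := T'.exists_dist_le_of_finite hA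
  have key : ∀ x y : G, T.cayleyGraph.dist (φ x) (φ y) ≤
      C * (K * (C' * T'.cayleyGraph.dist (φ x) (φ y) + C') + K) + C := by
    intro x y
    refine (h1 x y).trans ?_
    gcongr
    refine (hK _ _).trans ?_
    gcongr
    exact h2 x y
  refine GeneratingSet.le_iff.2
    ⟨C * K * C' + (C * (K * (C' * (2 * a') + C') + K) + C + 2 * a), fun x y => ?_⟩
  obtain ⟨x, s, hs, rfl⟩ := hsurj x
  obtain ⟨y, t, ht, rfl⟩ := hsurj y
  have e1 := ha (φ x) (φ x * s) (by simpa using hs)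
  have e2 := ha (φ y) (φ y * t) (by simpa using ht)
  have e1' := ha' (φ x) (φ x * s) (by simpa using hs)
  have e2' := ha' (φ y) (φ y * t) (by simpa using ht)
  have t1 := T.cayleyGraph_connected.dist_triangle (u := φ x * s) (v := φ x) (w := φ y * t)
  have t2 := T.cayleyGraph_connected.dist_triangle (u := φ x) (v := φ y) (w := φ y * t)
  have t1' := T'.cayleyGraph_connected.dist_triangle (u := φ x) (v := φ x * s) (w := φ y)
  have t2' := T'.cayleyGraph_connected.dist_triangle (u := φ x * s) (v := φ y * t) (w := φ y)
  rw [T.cayleyGraph.dist_comm (u := φ x * s) (v := φ x)] at t1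
  rw [T'.cayleyGraph.dist_comm (u := φ y * t) (v := φ y)] at t2'
  generalize T'.cayleyGraph.dist (φ x * s) (φ y * t) = n at *
  calc T.cayleyGraph.dist (φ x * s) (φ y * t)
      ≤ T.cayleyGraph.dist (φ x) (φ y) + 2 * a := by omega
    _ ≤ C * (K * (C' * (n + 2 * a') + C') + K) + C + 2 * a := by
        gcongr
        refine (key x y).trans ?_
        gcongr
        omega
    _ ≤ _ := by
        have : 0 ≤ (C * (K * (C' * (2 * a') + C') + K) + C + 2 * a) * n := Nat.zero_le _
        nlinarith [Nat.zero_le (C * K * C')]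

theorem IsQuasiIsometry.congr {φ : G → H} {S S' : GeneratingSet G} {T T' : GeneratingSet H}
    (h : IsQuasiIsometry S.cayleyGraph T.cayleyGraph φ)
    (hS : S ≤ S') (hS' : S' ≤ S) (hT : T ≤ T') (hT' : T' ≤ T) :
    IsQuasiIsometry S'.cayleyGraph T'.cayleyGraph φ := by
  obtain ⟨C, h1, h2, h3⟩ := isQuasiIsometry_iff.1 h
  obtain ⟨a, ha⟩ := GeneratingSet.le_iff.1 hS
  obtain ⟨a', ha'⟩ := GeneratingSet.le_iff.1 hS'
  obtain ⟨b, hb⟩ := GeneratingSet.le_iff.1 hT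
  obtain ⟨b', hb'⟩ := GeneratingSet.le_iff.1 hT'
  obtain ⟨M, hM⟩ : ∃ M, M = (a' * (C * b + C) + a') + (b' * (C * a + C) + b') := ⟨_, rfl⟩
  refine isQuasiIsometry_iff.2 ⟨M, fun x y => ?_, fun x y => ?_, fun w => ?_⟩
  · calc S'.cayleyGraph.dist x y
        ≤ a' * (C * (b * T'.cayleyGraph.dist (φ x) (φ y) + b) + C) + a' := by
          refine (ha' _ _).trans ?_
          gcongr
          refine (h1 _ _).trans ?_
          gcongr
          exact hb _ _
      _ ≤ (a' * (C * b + C) + a') * T'.cayleyGraph.dist (φ x) (φ y) + (a' * (C * b + C) + a') := by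
          have : 0 ≤ (a' * C + a') * T'.cayleyGraph.dist (φ x) (φ y) := Nat.zero_le _
          nlinarith
      _ ≤ _ := by gcongr <;> omega
  · calc T'.cayleyGraph.dist (φ x) (φ y)
        ≤ b' * (C * (a * S'.cayleyGraph.dist x y + a) + C) + b' := by
          refine (hb' _ _).trans ?_
          gcongr
          refine (h2 _ _).trans ?_
          gcongr
          exact ha _ _
      _ ≤ (b' * (C * a + C) + b') * S'.cayleyGraph.dist x y + (b' * (C * a + C) + b') := by
          have : 0 ≤ (b' * C + b') * S'.cayleyGraph.dist x y := Nat.zero_le _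
          nlinarith
      _ ≤ _ := by gcongr <;> omega
  · obtain ⟨x, hx⟩ := h3 w
    refine ⟨x, (hb' _ _).trans ?_⟩
    have h4 := Nat.mul_le_mul_left b' hx
    rw [hM, Nat.mul_add b']
    omega

/-- A coarse inverse of a quasi-isometry, with finite sets of errors, is a quasi-isometry. -/
theorem IsQuasiIsometry.of_finiteDist {φ : G → H} {ψ : H → G}
    (hψφ : FiniteDist (ψ ∘ φ) id) (hφψ : FiniteDist (φ ∘ ψ) id)
    {S : GeneratingSet G} {T : GeneratingSet H}
    (h : IsQuasiIsometry T.cayleyGraph S.cayleyGraph ψ) :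
    IsQuasiIsometry S.cayleyGraph T.cayleyGraph φ := by
  obtain ⟨C, h1, h2, -⟩ := isQuasiIsometry_iff.1 h
  obtain ⟨a, ha⟩ := S.exists_dist_le_of_finite hψφ
  obtain ⟨b, hb⟩ := T.exists_dist_le_of_finite hφψ
  have ha' : ∀ x, S.cayleyGraph.dist (ψ (φ x)) x ≤ a := fun x => ha _ _ ⟨x, rfl⟩
  have hb' : ∀ y, T.cayleyGraph.dist (φ (ψ y)) y ≤ b := fun y => hb _ _ ⟨y, rfl⟩
  refine isQuasiIsometry_iff.2 ⟨C * (2 * a) + C + 2 * a + b, fun x y => ?_, fun x y => ?_,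
    fun w => ⟨ψ w, (hb' w).trans (by omega)⟩⟩
  · have t1 := S.cayleyGraph_connected.dist_triangle (u := x) (v := ψ (φ x)) (w := y)
    have t2 := S.cayleyGraph_connected.dist_triangle (u := ψ (φ x)) (v := ψ (φ y)) (w := y)
    have t3 := S.cayleyGraph.dist_comm (u := x) (v := ψ (φ x))
    have := h2 (φ x) (φ y)
    have := ha' x
    have := ha' y
    rw [Nat.add_mul, Nat.add_mul, Nat.add_mul]
    omega
  · have t1 := S.cayleyGraph_connected.dist_triangle (u := ψ (φ x)) (v := x) (w := ψ (φ y))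
    have t2 := S.cayleyGraph_connected.dist_triangle (u := x) (v := y) (w := ψ (φ y))
    have t3 := S.cayleyGraph.dist_comm (u := y) (v := ψ (φ y))
    have h3 := h1 (φ x) (φ y)
    have h4 := ha' x
    have h5 := ha' y
    have h6 : C * S.cayleyGraph.dist (ψ (φ x)) (ψ (φ y)) ≤
        C * S.cayleyGraph.dist x y + C * (2 * a) := by
      rw [← Nat.mul_add]; exact Nat.mul_le_mul_left _ (by omega)
    rw [Nat.add_mul, Nat.add_mul, Nat.add_mul]
    omega

/-- Generating sets can be pulled back along coarsely surjective quasi-homomorphisms, in such a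
way that the quasi-homomorphism becomes a quasi-isometry. -/
theorem exists_isQuasiIsometry {φ : G → H} (hφ : IsQuasiHom φ) (hs : IsCoarselySurjective φ)
    (T : GeneratingSet H) :
    ∃ S : GeneratingSet G, IsQuasiIsometry S.cayleyGraph T.cayleyGraph φ := by
  obtain ⟨A, hA, hsurj⟩ := hs
  obtain ⟨α, hα⟩ := T.exists_dist_le_of_finite hA
  obtain ⟨β, hβ⟩ := T.exists_dist_le_of_finite hφ
  have hT := T.cayleyGraph_connected
  have hdefect : ∀ x y, T.cayleyGraph.dist (φ x * φ (x⁻¹ * y)) (φ y) ≤ β := fun x y =>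
    hβ _ _ ⟨x, x⁻¹ * y, by simp⟩
  have hnorm : ∀ x y, T.cayleyGraph.dist 1 (φ (x⁻¹ * y)) =
      T.cayleyGraph.dist (φ x) (φ x * φ (x⁻¹ * y)) := fun x y => by
    rw [← T.dist_mul_left (φ x), mul_one]
  -- Replacing neighbours in `H` by points of `φ(G)` gives distance at most `2 * α + 1`; the defect
  -- adds `β`.
  obtain ⟨s, hsdef⟩ : ∃ s : Set G, s = {g | T.cayleyGraph.dist 1 (φ g) ≤ 2 * α + 1 + β} := ⟨_, rfl⟩
  have hmem : ∀ x y, T.cayleyGraph.dist (φ x) (φ y) ≤ 2 * α + 1 → x⁻¹ * y ∈ s := by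
    intro x y h
    rw [hsdef, Set.mem_ofPred_eq, hnorm]
    have h1 := hT.dist_triangle (u := φ x) (v := φ y) (w := φ x * φ (x⁻¹ * y))
    have h2 := T.cayleyGraph.dist_comm (u := φ y) (v := φ x * φ (x⁻¹ * y))
    have h3 := hdefect x y
    omega
  have hmem' : ∀ x y, x⁻¹ * y ∈ s → T.cayleyGraph.dist (φ x) (φ y) ≤ 2 * α + 1 + 2 * β := by
    intro x y h
    rw [hsdef, Set.mem_ofPred_eq, hnorm] at h
    have h1 := hT.dist_triangle (u := φ x) (v := φ x * φ (x⁻¹ * y)) (w := φ y)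
    have h3 := hdefect x y
    omega
  -- A geodesic from `h` to `φ y` is shadowed in `G`, one edge per step plus a last one. Walks are
  -- used because `s` is not yet known to generate; `hgen` follows from them.
  have hwalk : ∀ n x y h, T.cayleyGraph.dist (φ x) h ≤ α → T.cayleyGraph.dist h (φ y) ≤ n →
      ∃ p : (mulCayley s).Walk x y, p.length ≤ n + 1 := by
    intro n
    induction n with
    | zero =>
      intro x y h hx hy
      rw [Nat.le_zero, hT.dist_eq_zero_iff] at hy
      subst hy
      by_cases hxy : x = y
      · subst hxy
        exact ⟨Walk.nil, by simp⟩
      · exact ⟨Walk.cons ((mulCayley_adj _ _ _).2 ⟨hxy, Or.inl (hmem x y (by omega))⟩) Walk.nil,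
          by simp⟩
    | succ n ih =>
      intro x y h hx hy
      rcases Nat.le_or_eq_of_le_succ hy with hy | hy
      · obtain ⟨p, hp⟩ := ih x y h hx hy
        exact ⟨p, by omega⟩
      · obtain ⟨h', hb, hh'⟩ := exists_between_dist_eq hT h (φ y) (k := 1) (by omega)
        obtain ⟨z, a, haA, rfl⟩ := hsurj h'
        have hz := hα (φ z) (φ z * a) (by simpa using haA)
        obtain ⟨p, hp⟩ := ih z y _ hz (by unfold Between at hb; omega)
        by_cases hxz : x = z
        · subst hxz
          exact ⟨p, by omega⟩
        · refine ⟨Walk.cons ((mulCayley_adj _ _ _).2 ⟨hxz, Or.inl (hmem x z ?_)⟩) p, by simpa⟩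
          have t1 := hT.dist_triangle (u := φ x) (v := h) (w := φ z)
          have t2 := hT.dist_triangle (u := h) (v := φ z * a) (w := φ z)
          have t3 := T.cayleyGraph.dist_comm (u := φ z) (v := φ z * a)
          omega
  have hgen : Subgroup.closure s = ⊤ := by
    rw [Subgroup.eq_top_iff']
    intro g
    obtain ⟨p, -⟩ := hwalk _ 1 g (φ 1) (by simp) le_rfl
    simpa using inv_mul_mem_closure_of_walk p
  refine ⟨⟨s, hgen⟩, isQuasiIsometry_iff.2 ⟨2 * α + 1 + 2 * β, fun x y => ?_, fun x y => ?_,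
    fun w => ?_⟩⟩
  · obtain ⟨p, hp⟩ := hwalk _ x y (φ x) (by simp) le_rfl
    have h1 : (GeneratingSet.mk s hgen).cayleyGraph.dist x y ≤ p.length := dist_le p
    have h2 : 1 * T.cayleyGraph.dist (φ x) (φ y) ≤
        (2 * α + 1 + 2 * β) * T.cayleyGraph.dist (φ x) (φ y) := Nat.mul_le_mul_right _ (by omega)
    omega
  · refine (dist_le_mul_of_adj hT (GeneratingSet.cayleyGraph_connected _)
      (fun x y h => ?_) x y).trans (Nat.le_add_right _ _)
    rcases ((mulCayley_adj s x y).1 h).2 with h | h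
    · exact hmem' x y h
    · rw [T.cayleyGraph.dist_comm]
      exact hmem' y x h
  · obtain ⟨x, a, ha, rfl⟩ := hsurj w
    exact ⟨x, (hα _ _ (by simpa using ha)).trans (by omega)⟩

theorem IsHyperbolicGraph.of_isQuasiIsometry {φ : G → H} {S : GeneratingSet G}
    {T : GeneratingSet H} (hT : IsHyperbolicGraph T.cayleyGraph)
    (h : IsQuasiIsometry S.cayleyGraph T.cayleyGraph φ) : IsHyperbolicGraph S.cayleyGraph := by
  obtain ⟨C, h1, h2, -⟩ := isQuasiIsometry_iff.1 h
  refine hT.of_quasiIsometricEmbedding T.cayleyGraph_connected S.cayleyGraph_connected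
    (f := φ) (K := 2 * C) (dist_le_mul_of_adj T.cayleyGraph_connected S.cayleyGraph_connected
      fun x y hxy => ?_) h1
  have := h2 x y
  rw [dist_eq_one_iff_adj.2 hxy] at this
  omega

theorem exists_orderEmbedding {φ : G → H} (hφ : IsQuasiHom φ) (hs : IsCoarselySurjective φ) :
    ∃ χ : HyperbolicStructure H ↪o HyperbolicStructure G,
      ∀ (T : GeneratingSet H) (hT : IsHyperbolicGraph T.cayleyGraph) (S : GeneratingSet G),
        (χ (T.structureOf hT) : GeneratingClass G) = S.cls ↔
          IsQuasiIsometry S.cayleyGraph T.cayleyGraph φ := by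
  -- Choosing representatives with each value avoids a well-definedness check;
  -- `IsQuasiIsometry.congr` later passes to arbitrary ones.
  have hex : ∀ c : HyperbolicStructure H, ∃ (d : HyperbolicStructure G) (S : GeneratingSet G)
      (T : GeneratingSet H), S.cls = d.1 ∧ T.cls = c.1 ∧
        IsQuasiIsometry S.cayleyGraph T.cayleyGraph φ := by
    rintro ⟨_, T, hT, rfl⟩
    obtain ⟨S, hS⟩ := exists_isQuasiIsometry hφ hs T
    exact ⟨S.structureOf (hT.of_isQuasiIsometry hS), S, T, rfl, rfl, hS⟩
  choose χ S T hχS hχT hqi using hex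
  refine ⟨OrderEmbedding.ofMapLEIff χ fun a b => ?_, fun T' hT' S' => ?_⟩
  · rw [← Subtype.coe_le_coe, ← Subtype.coe_le_coe, ← hχS, ← hχS, ← hχT, ← hχT,
      GeneratingSet.cls_le_cls, GeneratingSet.cls_le_cls]
    exact ⟨le_of_isCoarselySurjective hs (hqi a) (hqi b), le_of_isQuasiIsometry (hqi a) (hqi b)⟩
  · rw [OrderEmbedding.coe_ofMapLEIff, ← hχS]
    have hc : (T (T'.structureOf hT')).cls = T'.cls := hχT _
    have hq := hqi (T'.structureOf hT')
    have hT1 := GeneratingSet.cls_le_cls.1 hc.le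
    have hT2 := GeneratingSet.cls_le_cls.1 hc.ge
    constructor
    · intro h
      exact hq.congr (GeneratingSet.cls_le_cls.1 h.le) (GeneratingSet.cls_le_cls.1 h.ge) hT1 hT2
    · intro h
      exact le_antisymm (GeneratingSet.cls_le_cls.2 (le_of_isQuasiIsometry hq h hT1))
        (GeneratingSet.cls_le_cls.2 (le_of_isQuasiIsometry h hq hT2))

theorem FiniteDist.isCoarselySurjective {X : Type*} {φ : X → H} {ψ : H → X} (h : FiniteDist (φ ∘ ψ) id) :
    IsCoarselySurjective φ :=
  ⟨_, h, fun y => ⟨ψ y, _, ⟨y, rfl⟩, by simp⟩⟩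

theorem QuasiIsomorphic.nonempty_orderIso (h : QuasiIsomorphic G H) :
    Nonempty (HyperbolicStructure G ≃o HyperbolicStructure H) := by
  obtain ⟨φ, ψ, hφ, hψ, hψφ, hφψ⟩ := h
  obtain ⟨χ, hχ⟩ := exists_orderEmbedding hφ hφψ.isCoarselySurjective
  have hsurj : Function.Surjective χ := by
    rintro ⟨_, S, hS, rfl⟩
    -- The preimage of `[S]` is its pullback along `ψ`, since the coarse inverse `φ` is then a
    -- quasi-isometry too.
    obtain ⟨T, hT⟩ := exists_isQuasiIsometry hψ hψφ.isCoarselySurjective S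
    exact ⟨T.structureOf (hS.of_isQuasiIsometry hT),
      Subtype.ext ((hχ _ _ _).2 (hT.of_finiteDist hψφ hφψ))⟩
  exact ⟨(RelIso.ofSurjective χ hsurj).symm⟩

end QuasiIsometry

end HypStruct

theorem proposition1p7 {G H : Type*} [Group G] [Group H] :
    (∀ φ : G → H, HypStruct.IsQuasiHom φ → HypStruct.IsCoarselySurjective φ →
      ∃ χ : HypStruct.HyperbolicStructure H ↪o HypStruct.HyperbolicStructure G,
        ∀ (T : HypStruct.GeneratingSet H)
          (hT : HypStruct.IsHyperbolicGraph T.cayleyGraph) (S : HypStruct.GeneratingSet G),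
          (χ (T.structureOf hT) : HypStruct.GeneratingClass G) = S.cls ↔
            HypStruct.IsQuasiIsometry S.cayleyGraph T.cayleyGraph φ) ∧
    (HypStruct.QuasiIsomorphic G H →
      Nonempty (HypStruct.HyperbolicStructure G ≃o HypStruct.HyperbolicStructure H)) :=
  ⟨fun _ hφ hs => HypStruct.exists_orderEmbedding hφ hs, fun h => h.nonempty_orderIso⟩
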